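/- For a commutative ring $R$ let $U,V\colon R[[q]]\to R[[q]]$ be the maps $U(\sum_{n\ge0} r_nq^n)=\sum_{n\ge0} r_{3n}q^n$ and $V(\sum_{n\ge0} r_nq^n)=\sum_{n\ge0} r_nq^{3n}$. In $\mathbb{Q}[[q]]$ let $$\theta=\sum_{(a,b)\in\mathbb{Z}^2}q^{a^2+ab+b^2},\qquad y=\frac{\theta/V(\theta)-1}{6}=q-5q^4+\cdots,$$ $$\Delta(q)=q\prod_{n=1}^\infty(1-q^n)^{24},\qquad f=\sqrt{\Delta(q^3)/\Delta(q)}=q+12q^2+\cdots,$$ where the square root is the one with leading coefficient $1$. Then, in $\mathbb{Q}[[q]]$: 1. $U(y)=U(y^2)=0$ and $U(y^3)=\dfrac{y(1+3y+9y^2)}{(1+6y)^3}$. 2. For every integer $m\ge0$, $U(y^{3m+1})=U(y^{3m+2})=0$ and $U(y^{3m})=\left(\dfrac{y(1+3y+9y^2)}{(1+6y)^3}\right)^m$. 3. $f=\dfrac{y(1+3y+9y^2)}{(1-3y)^3}$, $\;U(f)=10\cdot3^2f+4\cdot3^7f^2+3^{11}f^3$, and $V(f)=\dfrac{y^3}{1-27y^3}$.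 -/

import Mathlib

open PowerSeries

namespace ThreeAdic

noncomputable section

/-- The operator `U (∑ rₙ qⁿ) = ∑ r₃ₙ qⁿ` on `R⟦q⟧`, an `R`-module homomorphism. -/
def U (R : Type*) [CommRing R] : R⟦X⟧ →ₗ[R] R⟦X⟧ where
  toFun g := PowerSeries.mk fun n => coeff (3 * n) g
  map_add' g h := by ext n; simp
  map_smul' r g := by ext n; simp

/-- The operator `V (∑ rₙ qⁿ) = ∑ rₙ q³ⁿ` on `R⟦q⟧`, an `R`-algebra homomorphism. -/
def V (R : Type*) [CommRing R] : R⟦X⟧ →ₐ[R] R⟦X⟧ :=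
  PowerSeries.expand 3 (by norm_num)

/-- The pairs `(a, b) ∈ ℤ²` with `a² + ab + b² = n`. -/
def thetaReps (n : ℕ) : Set (ℤ × ℤ) :=
  {p | p.1 ^ 2 + p.1 * p.2 + p.2 ^ 2 = (n : ℤ)}

theorem thetaReps_finite (n : ℕ) : (thetaReps n).Finite := by
  refine (Set.finite_Icc ((-(2 * n : ℤ), -(2 * n : ℤ)) : ℤ × ℤ) (2 * n, 2 * n)).subset ?_
  rintro ⟨a, b⟩ h
  have h' : a ^ 2 + a * b + b ^ 2 = (n : ℤ) := h
  have h1 : -(2 * n : ℤ) ≤ a := by nlinarith [sq_nonneg (a + 2 * b), sq_nonneg (a + 1)]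
  have h2 : -(2 * n : ℤ) ≤ b := by nlinarith [sq_nonneg (2 * a + b), sq_nonneg (b + 1)]
  have h3 : a ≤ 2 * n := by nlinarith [sq_nonneg (a + 2 * b), sq_nonneg (a - 1)]
  have h4 : b ≤ 2 * n := by nlinarith [sq_nonneg (2 * a + b), sq_nonneg (b - 1)]
  exact ⟨⟨h1, h2⟩, ⟨h3, h4⟩⟩

/-- The theta series `θ = ∑_{(a,b) ∈ ℤ²} q^(a² + ab + b²)`, collected by powers of `q`. -/
def theta : ℚ⟦X⟧ := PowerSeries.mk fun n => ((thetaReps n).ncard : ℚ)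

theorem constantCoeff_theta : constantCoeff theta = 1 := by
  have h : thetaReps 0 = {(0, 0)} := by
    ext ⟨a, b⟩
    simp only [thetaReps, Set.mem_setOf_eq, Set.mem_singleton_iff, Prod.mk.injEq, Nat.cast_zero]
    constructor
    · intro h
      have ha : a ^ 2 = 0 := by nlinarith [sq_nonneg (a + 2 * b), sq_nonneg a]
      have hb : b ^ 2 = 0 := by nlinarith [sq_nonneg (2 * a + b), sq_nonneg b]
      exact ⟨by simpa using ha, by simpa using hb⟩
    · rintro ⟨rfl, rfl⟩
      norm_num
  rw [← coeff_zero_eq_constantCoeff_apply, theta, coeff_mk, h, Set.ncard_singleton, Nat.cast_one]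

/-- The denominator `V θ` is an invertible power series. -/
theorem constantCoeff_V_theta : constantCoeff (V ℚ theta) = 1 := by
  rw [V, constantCoeff_expand, constantCoeff_theta]

/-- The level 9 Hauptmodul `y = (θ / V θ - 1) / 6`. -/
def y : ℚ⟦X⟧ := C (1 / 6 : ℚ) * (theta * (V ℚ theta)⁻¹ - 1)

open scoped PowerSeries.WithPiTopology in
/-- The discriminant `Δ = q ∏_{n ≥ 1} (1 - qⁿ)²⁴`, the infinite product being taken for
coefficientwise convergence. -/
def Delta : ℚ⟦X⟧ := X * ∏' n : ℕ, (1 - X ^ (n + 1) : ℚ⟦X⟧) ^ 24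

open scoped PowerSeries.WithPiTopology in
/-- The product defining `Δ` converges. -/
theorem multipliable_Delta : Multipliable fun n : ℕ => (1 - X ^ (n + 1) : ℚ⟦X⟧) ^ 24 :=
  (PowerSeries.WithPiTopology.multipliable_one_sub_X_pow ℚ).pow 24

open scoped PowerSeries.WithPiTopology in
theorem exists_Delta_eq : ∃ E : ℚ⟦X⟧, constantCoeff E = 1 ∧ Delta = X * E ^ 24 := by
  refine ⟨∏' n : ℕ, (1 - X ^ (n + 1) : ℚ⟦X⟧), ?_, ?_⟩
  · simp [(PowerSeries.WithPiTopology.multipliable_one_sub_X_pow ℚ).map_tprod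
      (constantCoeff (R := ℚ)) (PowerSeries.WithPiTopology.continuous_constantCoeff ℚ)]
  · rw [Delta, (PowerSeries.WithPiTopology.multipliable_one_sub_X_pow ℚ).tprod_pow]

theorem Delta_ne_zero : Delta ≠ 0 := by
  obtain ⟨E, hE, h⟩ := exists_Delta_eq
  rw [h]
  refine mul_ne_zero X_ne_zero (pow_ne_zero _ ?_)
  rintro rfl
  simp at hE

/-- `Δ(q³) / Δ(q)` has exactly one square root in `ℚ⟦q⟧` of the form `q + ⋯`. -/
theorem existsUnique_sqrt : ∃! g : ℚ⟦X⟧, g ^ 2 * Delta = V ℚ Delta ∧ coeff 1 g = 1 := by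
  obtain ⟨E, hE, h⟩ := exists_Delta_eq
  have hc : constantCoeff (E ^ 12) ≠ 0 := by simp [hE]
  refine ⟨X * (V ℚ E ^ 12 * (E ^ 12)⁻¹), ⟨?_, ?_⟩, ?_⟩
  · have hinv := PowerSeries.inv_mul_cancel (E ^ 12) hc
    have hV : V ℚ Delta = X ^ 3 * V ℚ E ^ 24 := by
      rw [h, map_mul, map_pow]
      congr 1
      exact expand_X 3 _
    rw [hV, h]
    calc (X * (V ℚ E ^ 12 * (E ^ 12)⁻¹)) ^ 2 * (X * E ^ 24)
        = X ^ 3 * V ℚ E ^ 24 * ((E ^ 12)⁻¹ * E ^ 12) ^ 2 := by ring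
      _ = X ^ 3 * V ℚ E ^ 24 := by rw [hinv]; ring
  · rw [show (1 : ℕ) = 0 + 1 from rfl, coeff_succ_X_mul]
    simp [V, hE]
  · set g₀ : ℚ⟦X⟧ := X * (V ℚ E ^ 12 * (E ^ 12)⁻¹) with hg₀
    have hsq : g₀ ^ 2 * Delta = V ℚ Delta := by
      have hinv := PowerSeries.inv_mul_cancel (E ^ 12) hc
      have hV : V ℚ Delta = X ^ 3 * V ℚ E ^ 24 := by
        rw [h, map_mul, map_pow]
        congr 1
        exact expand_X 3 _
      rw [hV, h, hg₀]
      calc (X * (V ℚ E ^ 12 * (E ^ 12)⁻¹)) ^ 2 * (X * E ^ 24)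
          = X ^ 3 * V ℚ E ^ 24 * ((E ^ 12)⁻¹ * E ^ 12) ^ 2 := by ring
        _ = X ^ 3 * V ℚ E ^ 24 := by rw [hinv]; ring
    have h1 : coeff 1 g₀ = 1 := by
      rw [hg₀, show (1 : ℕ) = 0 + 1 from rfl, coeff_succ_X_mul]
      simp [V, hE]
    rintro g ⟨hg, hg1⟩
    have := mul_right_cancel₀ Delta_ne_zero (hg.trans hsq.symm)
    rcases sq_eq_sq_iff_eq_or_eq_neg.mp this with h2 | h2
    · exact h2
    · rw [h2, map_neg, h1] at hg1
      norm_num at hg1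

/-- `f = √(Δ(q³) / Δ(q)) = q + ⋯`, the square root being the one with leading coefficient `1`. -/
def f : ℚ⟦X⟧ := existsUnique_sqrt.choose

theorem f_spec : f ^ 2 * Delta = V ℚ Delta ∧ coeff 1 f = 1 := existsUnique_sqrt.choose_spec.1

end

end ThreeAdic

/-!
All identities come down to three facts about `E = ∏ (1 - qⁿ)` and the theta series `θ`; below,
`φ(q³)` is `V φ`, and `g = ∑ q^(3(a² + ab + b²) + a + 2b)` is the theta series of a shifted lattice.

* `theta_eq`: `θ(q) = θ(q³) + 6 q g(q³)`. Vectors of norm divisible by `3` form the sublattice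
  `√-3 · ℤ[ω]`, and the vectors of norm `1` modulo `3` fall into six classes permuted by the units.
  Hence `y = q g(q³) / θ(q³)`, so `U y = U y² = 0` and `y³` is the image under `V` of `cubeY`.
* `V_eulerProd_pow_three` and `eulerProd_pow_three`: `E(q³)³ = E(q) g(q)` and
  `E(q)³ = E(q³) (θ(q³) - 3 q g(q³))`. Take three Jacobi theta products in a variable `t`, with `t`
  multiplied by the three cube roots of unity or by `1, q, q²`. Their product is again a single
  theta product, and comparing constant terms in `t` expresses a sum over the lattice
  `i + j + k = 0` as a quotient of Euler products. To stay inside formal power series, this is done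
  for the finite products `∏_{i < 2N} (1 - pⁱ t)`, whose coefficients are Gaussian binomials
  (`coeff_rothePoly`); near the centre of a row these tend `q`-adically to `1 / ∏ (1 - pⁱ)`, and
  `IsEulerProd.pow_three_eq` lets `N` tend to infinity.
* `V_eulerProd_pow_nine`: `E(q³)⁹ / E(q⁹)³ = θ(q³)³ - 27 q³ g(q³)³`. Multiply the formula for
  `E(q)³` over the substitutions `q ↦ ζ q`, which fix every series in `q³`; the product of the
  `E(ζ q)` is `E(q³)⁴ / E(q⁹)` by `IsEulerProd.mul_twist`.

Together they give `q g³ = q g(q³) (A² + 3 A q g(q³) + 9 q² g(q³)²)` with `A = θ(q³)`, from which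
`cubeY = y (1 + 3 y + 9 y²) / (1 + 6 y)³`. With `f = q E(q³)¹² / E(q)¹²`, they also give
`f = y (1 + 3 y + 9 y²) / (1 - 3 y)³` and `V f = y³ / (1 - 27 y³)`, that is
`f = cubeY / (1 - 27 cubeY)`. Finally `(1 - 3 y)(1 + 3 y + 9 y²) = 1 - 27 y³` lies in the image of
`V`, over which `U` is linear, so that `U f` follows from the action of `U` on powers of `y`.
-/

namespace ThreeAdic

/-! ### Gaussian binomials and the finite triple product -/

section GaussBinom

variable {S : Type*} [CommRing S]

/-- The `q`-Pochhammer symbol `(p; p)ₙ = ∏_{1 ≤ i ≤ n} (1 - pⁱ)`. -/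
def qPoch (p : S) (n : ℕ) : S := ∏ i ∈ Finset.range n, (1 - p ^ (i + 1))

theorem qPoch_succ (p : S) (n : ℕ) : qPoch p (n + 1) = qPoch p n * (1 - p ^ (n + 1)) :=
  Finset.prod_range_succ _ _

/-- The Gaussian binomial coefficient with base `p`, defined by the `q`-Pascal rule. -/
def gaussBinom (p : S) : ℕ → ℕ → S
  | _, 0 => 1
  | 0, _ + 1 => 0
  | n + 1, k + 1 => gaussBinom p n k + p ^ (k + 1) * gaussBinom p n (k + 1)

@[simp] theorem gaussBinom_zero_right (p : S) (n : ℕ) : gaussBinom p n 0 = 1 := by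
  cases n <;> rfl

theorem gaussBinom_succ_succ (p : S) (n k : ℕ) :
    gaussBinom p (n + 1) (k + 1) = gaussBinom p n k + p ^ (k + 1) * gaussBinom p n (k + 1) := rfl

theorem gaussBinom_eq_zero_of_lt (p : S) {n k : ℕ} (h : n < k) : gaussBinom p n k = 0 := by
  induction n generalizing k with
  | zero => obtain ⟨k, rfl⟩ := Nat.exists_eq_succ_of_ne_zero h.ne'; rfl
  | succ n ih =>
    obtain ⟨k, rfl⟩ := Nat.exists_eq_succ_of_ne_zero (Nat.ne_zero_of_lt h)
    rw [gaussBinom_succ_succ, ih (by omega), ih (by omega)]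
    ring

theorem gaussBinom_mul_qPoch (p : S) (m k : ℕ) :
    gaussBinom p (m + k) k * qPoch p k * qPoch p m = qPoch p (m + k) := by
  induction k generalizing m with
  | zero => simp [qPoch]
  | succ k ihk =>
    induction m with
    | zero =>
      have h := ihk 0
      rw [zero_add] at h ⊢
      rw [gaussBinom_succ_succ, gaussBinom_eq_zero_of_lt p (Nat.lt_succ_self k), qPoch_succ]
      linear_combination (1 - p ^ (k + 1)) * h
    | succ m ihm =>
      have h := ihk (m + 1)
      rw [show m + 1 + (k + 1) = (m + 1 + k) + 1 by ring, gaussBinom_succ_succ, qPoch_succ p (_ + k)]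
      rw [show m + (k + 1) = m + 1 + k by ring] at ihm
      rw [qPoch_succ p k] at ihm ⊢
      rw [qPoch_succ p m] at h ⊢
      linear_combination (1 - p ^ (k + 1)) * h + p ^ (k + 1) * (1 - p ^ (m + 1)) * ihm

/-- The finite product `∏_{i < n} (1 + pⁱ u t)` as a polynomial in `t`. -/
noncomputable def rothePoly (p u : S) (n : ℕ) : Polynomial S :=
  ∏ i ∈ Finset.range n, (1 + Polynomial.C (p ^ i * u) * Polynomial.X)

/-- Rothe's `q`-binomial theorem. -/
theorem coeff_rothePoly (p u : S) (n k : ℕ) :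
    (rothePoly p u n).coeff k = p ^ (k.choose 2) * gaussBinom p n k * u ^ k := by
  induction n generalizing u k with
  | zero =>
    cases k with
    | zero => simp [rothePoly]
    | succ k => simp [rothePoly, Polynomial.coeff_one, gaussBinom]
  | succ n ih =>
    have h : rothePoly p u (n + 1) =
        rothePoly p (p * u) n + Polynomial.C u * (rothePoly p (p * u) n * Polynomial.X) := by
      rw [rothePoly, Finset.prod_range_succ', rothePoly]
      simp only [pow_succ, mul_assoc, pow_zero, one_mul]
      ring
    rw [h]
    cases k with
    | zero => simp [ih]
    | succ k =>
      rw [Polynomial.coeff_add, Polynomial.coeff_C_mul, Polynomial.coeff_mul_X, ih, ih,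
        gaussBinom_succ_succ, Nat.choose_succ_succ' k 1, Nat.choose_one_right]
      ring

/-- The coefficient of `tⁿ` in a product of three Rothe polynomials. -/
theorem coeff_rothePoly_mul (p u v w : S) (m n : ℕ) :
    (rothePoly p u m * (rothePoly p v m * rothePoly p w m)).coeff n =
      ∑ a ∈ Finset.HasAntidiagonal.antidiagonal n, ∑ b ∈ Finset.HasAntidiagonal.antidiagonal a.2,
        p ^ (a.1.choose 2 + b.1.choose 2 + b.2.choose 2) *
          (gaussBinom p m a.1 * gaussBinom p m b.1 * gaussBinom p m b.2) *
          (u ^ a.1 * v ^ b.1 * w ^ b.2) := by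
  simp only [Polynomial.coeff_mul, coeff_rothePoly, Finset.mul_sum]
  refine Finset.sum_congr rfl fun a _ => Finset.sum_congr rfl fun b _ => ?_
  ring

/-- Interleaving three progressions of factors: `∏ᵢ (1 + p³ⁱ u t)(1 + p³ⁱ⁺¹ u t)(1 + p³ⁱ⁺² u t)`. -/
theorem rothePoly_mul_interleave (p u : S) (n : ℕ) :
    rothePoly (p ^ 3) u n * (rothePoly (p ^ 3) (p * u) n * rothePoly (p ^ 3) (p ^ 2 * u) n) =
      rothePoly p u (3 * n) := by
  induction n with
  | zero => simp [rothePoly]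
  | succ n ih =>
    have h1 : ∀ q v : S, rothePoly q v (n + 1) =
        rothePoly q v n * (1 + Polynomial.C (q ^ n * v) * Polynomial.X) :=
      fun q v => Finset.prod_range_succ _ _
    have h2 : rothePoly p u (3 * (n + 1)) = rothePoly p u (3 * n) *
        (1 + Polynomial.C (p ^ (3 * n) * u) * Polynomial.X) *
        (1 + Polynomial.C (p ^ (3 * n + 1) * u) * Polynomial.X) *
        (1 + Polynomial.C (p ^ (3 * n + 2) * u) * Polynomial.X) := by
      rw [show 3 * (n + 1) = 3 * n + 1 + 1 + 1 by ring]
      simp only [rothePoly, Finset.prod_range_succ]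
    rw [h1, h1, h1, h2, ← ih]
    simp only [← pow_mul, map_mul, map_pow]
    ring

/-- Multiplying over the cube roots of unity replaces `t` by `t³` and the base `p` by `p³`. -/
theorem rothePoly_mul_twist (p ζ : S) (hζ : 1 + ζ + ζ ^ 2 = 0) (n : ℕ) :
    rothePoly p (-1) n * (rothePoly p (-ζ) n * rothePoly p (-ζ ^ 2) n) =
      Polynomial.expand S 3 (rothePoly (p ^ 3) (-1) n) := by
  have h3 : ζ ^ 3 = 1 := by linear_combination (ζ - 1) * hζ
  simp only [rothePoly, map_prod, ← Finset.prod_mul_distrib]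
  refine Finset.prod_congr rfl fun i _ => ?_
  have h1 : (1 + Polynomial.C ζ + Polynomial.C ζ ^ 2 : Polynomial S) = 0 := by
    rw [← map_pow, ← map_one Polynomial.C, ← map_add, ← map_add, hζ, map_zero]
  have h2 : (Polynomial.C ζ ^ 3 : Polynomial S) = 1 := by rw [← map_pow, h3, map_one]
  simp only [map_add, map_one, map_mul, Polynomial.expand_C, Polynomial.expand_X, map_pow, map_neg]
  generalize (Polynomial.C p) = P
  rw [← pow_mul, mul_comm 3 i, pow_mul]
  generalize P ^ i = Q
  generalize hz : Polynomial.C ζ = z at h1 h2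
  linear_combination (-Q * Polynomial.X + (z * Q ^ 2 * Polynomial.X ^ 2)) * h1 -
    Q ^ 3 * Polynomial.X ^ 3 * h2

end GaussBinom

/-! ### Theta sums as product quotients -/

section Limit

variable {R : Type*} [CommRing R]

/-- `E` is the infinite product `∏_{n ≥ 1} (1 - q^(dn))`, expressed by congruences to the finite
products, so that no topology on `R` is needed. -/
def IsEulerProd (d : ℕ) (E : R⟦X⟧) : Prop :=
  ∀ n : ℕ, (X : R⟦X⟧) ^ (d * (n + 1)) ∣ E - qPoch (X ^ d) n

theorem IsEulerProd.constantCoeff_eq_one {d : ℕ} {E : R⟦X⟧} (hd : 0 < d) (hE : IsEulerProd d E) :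
    constantCoeff E = 1 := by
  have h1 : (X : R⟦X⟧) ∣ E - 1 := by
    have h := hE 0
    simp only [qPoch, Finset.range_zero, Finset.prod_empty] at h
    exact (dvd_pow_self X (by omega)).trans h
  simpa [sub_eq_zero] using X_dvd_iff.mp h1

theorem IsEulerProd.isUnit {d : ℕ} {E : R⟦X⟧} (hd : 0 < d) (hE : IsEulerProd d E) : IsUnit E := by
  rw [isUnit_iff_constantCoeff, hE.constantCoeff_eq_one hd]
  exact isUnit_one

/-- A Gaussian binomial far from the boundary of its row is close to `1 / ∏ (1 - q^(dn))`. -/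
theorem IsEulerProd.dvd_gaussBinom_mul_sub_one {d : ℕ} {E : R⟦X⟧} (hd : 0 < d)
    (hE : IsEulerProd d E) {m k l : ℕ} (hm : l ≤ m) (hk : l ≤ k) :
    (X : R⟦X⟧) ^ (d * (l + 1)) ∣ gaussBinom (X ^ d) (m + k) k * E - 1 := by
  have key : ∀ n, l ≤ n → (X : R⟦X⟧) ^ (d * (l + 1)) ∣ E - qPoch (X ^ d) n := fun n hn =>
    (pow_dvd_pow X (Nat.mul_le_mul_left d (by omega))).trans (hE n)
  obtain ⟨r₁, h₁⟩ := key k hk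
  obtain ⟨r₂, h₂⟩ := key m hm
  obtain ⟨r₃, h₃⟩ := key (m + k) (by omega)
  have h := gaussBinom_mul_qPoch (X ^ d : R⟦X⟧) m k
  rw [← (hE.isUnit hd).dvd_mul_left]
  refine ⟨gaussBinom (X ^ d) (m + k) k * (r₁ * E + r₂ * qPoch (X ^ d) k) - r₃, ?_⟩
  generalize (X : R⟦X⟧) ^ (d * (l + 1)) = D at *
  linear_combination h + gaussBinom (X ^ d) (m + k) k * E * h₁ +
    gaussBinom (X ^ d) (m + k) k * qPoch (X ^ d) k * h₂ - h₃

/-- The exponent `d (a² + ab + b²) + s (a + 2b)` of a shifted theta sum. It is nonnegative when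
`3 s ≤ d`, see `coe_thetaExp`. -/
def thetaExp (d s : ℕ) (p : ℤ × ℤ) : ℕ :=
  (d * (p.1 ^ 2 + p.1 * p.2 + p.2 ^ 2) + s * (p.1 + 2 * p.2)).toNat

/-- The weight `ζ ^ (a + 2b)` of a theta sum, for a cube root of unity `ζ`. -/
def thetaWeight (ζ : R) (p : ℤ × ℤ) : R := ζ ^ ((p.1 + 2 * p.2) % 3).toNat

theorem coe_thetaExp {d s : ℕ} (hs : 3 * s ≤ d) (p : ℤ × ℤ) :
    (thetaExp d s p : ℤ) = d * (p.1 ^ 2 + p.1 * p.2 + p.2 ^ 2) + s * (p.1 + 2 * p.2) := by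
  obtain ⟨a, b⟩ := p
  refine Int.toNat_of_nonneg ?_
  obtain ⟨t, rfl⟩ := Nat.exists_eq_add_of_le hs
  have h1 : 0 ≤ a ^ 2 + a * b + b ^ 2 := by nlinarith [sq_nonneg (2 * a + b), sq_nonneg b]
  have h2 : 0 ≤ 3 * (a ^ 2 + a * b + b ^ 2) + a + 2 * b := by
    by_contra! h
    nlinarith [sq_nonneg (2 * a + b), sq_nonneg (3 * b + 1)]
  push_cast
  nlinarith [mul_nonneg (Int.natCast_nonneg t) h1, mul_nonneg (Int.natCast_nonneg s) h2]

/-- The exponents grow at least linearly in each of the three lattice coordinates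
`a`, `b`, `-a - b`. -/
theorem mul_abs_le_thetaExp_add {d s : ℕ} (hs : 3 * s ≤ d) (a b : ℤ) :
    d * |a| ≤ thetaExp d s (a, b) + (d : ℤ) ∧ d * |b| ≤ thetaExp d s (a, b) + (d : ℤ) ∧
      d * |a + b| ≤ thetaExp d s (a, b) + (d : ℤ) := by
  rw [coe_thetaExp hs]
  obtain ⟨t, rfl⟩ := Nat.exists_eq_add_of_le hs
  have key : ∀ w : ℤ, |w| ≤ a ^ 2 + a * b + b ^ 2 + 1 →
      3 * |w| ≤ 3 * (a ^ 2 + a * b + b ^ 2) + (a + 2 * b) + 3 →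
      ((3 * s + t : ℕ) : ℤ) * |w| ≤
        (3 * s + t : ℕ) * (a ^ 2 + a * b + b ^ 2) + s * (a + 2 * b) + ((3 * s + t : ℕ) : ℤ) := by
    intro w h1 h2
    push_cast
    nlinarith [mul_nonneg (Int.natCast_nonneg t) (sub_nonneg.mpr h1),
      mul_nonneg (Int.natCast_nonneg s) (sub_nonneg.mpr h2)]
  refine ⟨key _ (abs_le.mpr ⟨?_, ?_⟩) ?_,
    key _ (abs_le.mpr ⟨?_, ?_⟩) ?_,
    key _ (abs_le.mpr ⟨?_, ?_⟩) ?_⟩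
  · nlinarith [sq_nonneg (2 * b + a), sq_nonneg (a + 2), sq_nonneg a]
  · nlinarith [sq_nonneg (2 * b + a), sq_nonneg (a - 2), sq_nonneg a]
  · rcases abs_cases a with ⟨h, _⟩ | ⟨h, _⟩ <;> rw [h] <;>
    nlinarith [sq_nonneg (6 * b + 2 + 3 * a), sq_nonneg (3 * a - 2), sq_nonneg (3 * a + 2)]
  · nlinarith [sq_nonneg (2 * a + b), sq_nonneg (b + 2), sq_nonneg b]
  · nlinarith [sq_nonneg (2 * a + b), sq_nonneg (b - 2), sq_nonneg b]
  · rcases abs_cases b with ⟨h, _⟩ | ⟨h, _⟩ <;> rw [h] <;>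
    nlinarith [sq_nonneg (6 * a + 3 * b + 1), sq_nonneg (3 * b - 1), sq_nonneg (3 * b + 3)]
  · nlinarith [sq_nonneg (a - b), sq_nonneg (a + b + 2), sq_nonneg (a + b)]
  · nlinarith [sq_nonneg (a - b), sq_nonneg (a + b - 2), sq_nonneg (a + b)]
  · rcases abs_cases (a + b) with ⟨h, _⟩ | ⟨h, _⟩ <;> rw [h] <;>
    nlinarith [sq_nonneg (3 * a - 3 * b - 1), sq_nonneg (3 * a + 3 * b - 1),
      sq_nonneg (3 * a + 3 * b + 3)]

open Finset.HasAntidiagonal in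
/-- The central coefficient of the product of three Rothe polynomials, written over the
hexagonal lattice: the index `(i, j, k)` with `i + j + k = 3 N` is the lattice point
`(j - N, k - N)`. -/
theorem coeff_rothePoly_mul_eq_thetaExp {d s : ℕ} (hs : 3 * s ≤ d) {ζ : R} (hζ : ζ ^ 3 = 1)
    {N : ℕ} {H : R⟦X⟧}
    (hH : (rothePoly (X ^ d) (-1) (2 * N) * (rothePoly (X ^ d) (-(C ζ * X ^ s)) (2 * N) *
      rothePoly (X ^ d) (-(C ζ * X ^ s) ^ 2) (2 * N))).coeff (3 * N) =
        (-1) ^ N * X ^ (3 * (d * N.choose 2 + s * N)) * H) :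
    H = ∑ a ∈ antidiagonal (3 * N), ∑ b ∈ antidiagonal a.2,
      C (thetaWeight ζ ((b.1 : ℤ) - N, (b.2 : ℤ) - N)) *
        X ^ thetaExp d s ((b.1 : ℤ) - N, (b.2 : ℤ) - N) *
        (gaussBinom (X ^ d) (2 * N) a.1 * gaussBinom (X ^ d) (2 * N) b.1 *
          gaussBinom (X ^ d) (2 * N) b.2) := by
  have hreg : ∀ (k : ℕ) (A B : R⟦X⟧), X ^ k * A = X ^ k * B → A = B := by
    intro k A B h
    ext n
    have := congrArg (coeff (n + k)) h
    simpa only [coeff_X_pow_mul] using this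
  refine hreg (3 * (d * N.choose 2 + s * N)) _ _ ?_
  have hsign : ((-1) ^ N * (-1) ^ N : R⟦X⟧) = 1 := by rw [← mul_pow]; simp
  calc _ = (-1) ^ N * ((-1) ^ N * X ^ (3 * (d * N.choose 2 + s * N)) * H) := by
        linear_combination (-(X ^ (3 * (d * N.choose 2 + s * N)) * H)) * hsign
    _ = _ := by
        rw [← hH, coeff_rothePoly_mul]
        simp only [Finset.mul_sum]
        refine Finset.sum_congr rfl fun a ha => Finset.sum_congr rfl fun b hb => ?_
        obtain ⟨i, m⟩ := a
        obtain ⟨j, k⟩ := b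
        rw [mem_antidiagonal] at ha hb
        simp only at ha hb ⊢
        have hexp : d * (i.choose 2 + j.choose 2 + k.choose 2) + s * (j + 2 * k) =
            3 * (d * N.choose 2 + s * N) + thetaExp d s ((j : ℤ) - N, (k : ℤ) - N) := by
          have hc : ∀ n : ℕ, 2 * ((n.choose 2 : ℕ) : ℤ) = (n : ℤ) * (n - 1) := by
            intro n
            induction n with
            | zero => simp
            | succ n ih =>
              rw [Nat.choose_succ_succ' n 1, Nat.choose_one_right]
              push_cast
              linarith
          have hi : (i : ℤ) = 3 * N - j - k := by omega
          have hi' := hc i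
          rw [hi] at hi'
          zify
          rw [coe_thetaExp hs]
          refine mul_left_cancel₀ (two_ne_zero (α := ℤ)) ?_
          simp only
          linear_combination (d : ℤ) * (hi' + hc j + hc k - 3 * hc N)
        have hw : ζ ^ (j + 2 * k) = thetaWeight ζ ((j : ℤ) - N, (k : ℤ) - N) := by
          rw [pow_eq_pow_mod _ hζ, thetaWeight]
          congr 1
          simp only
          omega
        have hsgn : ((-1) ^ N * ((-1) ^ i * (-1) ^ j * (-1) ^ k) : R⟦X⟧) = 1 := by
          rw [← pow_add, ← pow_add, ← pow_add]
          exact Even.neg_one_pow ⟨2 * N, by omega⟩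
        have e1 : (-(C ζ * X ^ s)) ^ j = (-1 : R⟦X⟧) ^ j * C (ζ ^ j) * X ^ (s * j) := by
          rw [neg_pow, mul_pow, ← pow_mul, map_pow]; ring
        have e2 : (-(C ζ * X ^ s) ^ 2) ^ k = (-1 : R⟦X⟧) ^ k * C (ζ ^ (2 * k)) * X ^ (s * (2 * k)) := by
          rw [neg_pow, ← pow_mul, mul_pow, ← pow_mul, map_pow]; ring
        rw [e1, e2, ← hw, pow_add ζ, map_mul]
        have e3 : (X : R⟦X⟧) ^ (3 * (d * N.choose 2 + s * N)) *
            X ^ thetaExp d s ((j : ℤ) - N, (k : ℤ) - N) =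
            (X ^ d) ^ (i.choose 2 + j.choose 2 + k.choose 2) * X ^ (s * j) * X ^ (s * (2 * k)) := by
          rw [← pow_add, ← hexp, ← pow_mul]
          ring
        generalize gaussBinom (X ^ d : R⟦X⟧) (2 * N) i = g₁
        generalize gaussBinom (X ^ d : R⟦X⟧) (2 * N) j = g₂
        generalize gaussBinom (X ^ d : R⟦X⟧) (2 * N) k = g₃
        generalize (X : R⟦X⟧) ^ thetaExp d s ((j : ℤ) - N, (k : ℤ) - N) = t at e3 ⊢
        linear_combination (g₁ * g₂ * g₃ * C (ζ ^ j) * C (ζ ^ (2 * k)) *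
          ((X ^ d) ^ (i.choose 2 + j.choose 2 + k.choose 2) * X ^ (s * j) * X ^ (s * (2 * k)))) *
          hsgn - g₁ * g₂ * g₃ * C (ζ ^ j) * C (ζ ^ (2 * k)) * e3

open Finset.HasAntidiagonal in
/-- Letting `N → ∞` in the identity for the central coefficients `H N`: the cube of the product
`E` is the theta sum `T` times the limit `E'` of `1 / H N`. -/
theorem IsEulerProd.pow_three_eq {d s : ℕ} (hd : 0 < d) (hs : 3 * s ≤ d) {ζ : R} (hζ : ζ ^ 3 = 1)
    {E E' T : R⟦X⟧} {H : ℕ → R⟦X⟧} (hE : IsEulerProd d E)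
    (hH : ∀ N, (rothePoly (X ^ d) (-1) (2 * N) * (rothePoly (X ^ d) (-(C ζ * X ^ s)) (2 * N) *
      rothePoly (X ^ d) (-(C ζ * X ^ s) ^ 2) (2 * N))).coeff (3 * N) =
        (-1) ^ N * X ^ (3 * (d * N.choose 2 + s * N)) * H N)
    (hE' : ∀ N, (X : R⟦X⟧) ^ N ∣ H N * E' - 1) {F : ℕ → Finset (ℤ × ℤ)}
    (hF : ∀ n p, p ∈ F n ↔ thetaExp d s p = n)
    (hT : ∀ n, coeff n T = ∑ p ∈ F n, thetaWeight ζ p) : E ^ 3 = E' * T := by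
  suffices h : ∀ N, (X : R⟦X⟧) ^ N ∣ E ^ 3 - E' * T by
    ext n
    simpa [sub_eq_zero] using X_pow_dvd_iff.mp (h (n + 1)) n (Nat.lt_succ_self n)
  intro N
  set S : R⟦X⟧ := ∑ a ∈ antidiagonal (3 * N), ∑ b ∈ antidiagonal a.2,
      C (thetaWeight ζ ((b.1 : ℤ) - N, (b.2 : ℤ) - N)) *
        X ^ thetaExp d s ((b.1 : ℤ) - N, (b.2 : ℤ) - N) with hS
  -- each Gaussian binomial is close to `1 / E` unless its index is far from the centre, and then
  -- the theta exponent `e` is large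
  have hbd : ∀ (e i : ℕ), d * |(i : ℤ) - N| ≤ e + (d : ℤ) →
      (X : R⟦X⟧) ^ N ∣ X ^ e * (gaussBinom (X ^ d) (2 * N) i * E - 1) := by
    intro e i h
    by_cases hlt : (N : ℤ) < |(i : ℤ) - N|
    · refine Dvd.dvd.mul_right (pow_dvd_pow X ?_) _
      zify
      nlinarith
    · obtain ⟨r, hr⟩ : ∃ r : ℕ, (r : ℤ) = |(i : ℤ) - N| := ⟨_, Int.natCast_natAbs _⟩
      have hir : i ≤ 2 * N := by
        rw [not_lt, abs_le] at hlt; omega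
      obtain ⟨m, hm⟩ := Nat.exists_eq_add_of_le' hir
      have hrN : r ≤ N := by omega
      obtain ⟨l, rfl⟩ := Nat.exists_eq_add_of_le hrN
      have := abs_le.mp hr.ge
      have h1 := hE.dvd_gaussBinom_mul_sub_one hd (m := m) (k := i) (l := l) (by omega) (by omega)
      rw [← hm] at h1
      refine dvd_trans ?_ (mul_dvd_mul_left (X ^ e) h1)
      rw [← pow_add]
      refine pow_dvd_pow X ?_
      rw [← hr] at h
      zify
      nlinarith
  have h1 : (X : R⟦X⟧) ^ N ∣ H N * E ^ 3 - S := by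
    rw [coeff_rothePoly_mul_eq_thetaExp hs hζ (hH N), hS, Finset.sum_mul, ← Finset.sum_sub_distrib]
    refine Finset.dvd_sum fun a ha => ?_
    rw [Finset.sum_mul, ← Finset.sum_sub_distrib]
    refine Finset.dvd_sum fun b hb => ?_
    obtain ⟨i, m⟩ := a
    obtain ⟨j, k⟩ := b
    rw [mem_antidiagonal] at ha hb
    simp only at ha hb ⊢
    obtain ⟨h1, h2, h3⟩ := mul_abs_le_thetaExp_add hs ((j : ℤ) - N) ((k : ℤ) - N)
    have hi : |((j : ℤ) - N) + ((k : ℤ) - N)| = |(i : ℤ) - N| := by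
      rw [← abs_neg]; congr 1; omega
    rw [hi] at h3
    obtain ⟨r₁, h₁⟩ := hbd _ _ h1
    obtain ⟨r₂, h₂⟩ := hbd _ _ h2
    obtain ⟨r₃, h₃⟩ := hbd _ _ h3
    generalize gaussBinom (X ^ d : R⟦X⟧) (2 * N) i = g₃ at *
    generalize gaussBinom (X ^ d : R⟦X⟧) (2 * N) j = g₁ at *
    generalize gaussBinom (X ^ d : R⟦X⟧) (2 * N) k = g₂ at *
    generalize (X : R⟦X⟧) ^ thetaExp d s ((j : ℤ) - N, (k : ℤ) - N) = t at *
    generalize thetaWeight ζ ((j : ℤ) - N, (k : ℤ) - N) = w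
    refine ⟨C w * (r₁ * (g₂ * E) * (g₃ * E) + r₂ * (g₃ * E) + r₃), ?_⟩
    linear_combination C w * (g₂ * E) * (g₃ * E) * h₁ + C w * (g₃ * E) * h₂ + C w * h₃
  -- every lattice point with theta exponent below `N` occurs in the truncated sum `S`
  have h2 : (X : R⟦X⟧) ^ N ∣ T - S := by
    rw [X_pow_dvd_iff]
    intro n hn
    rw [map_sub, hT, sub_eq_zero, hS, Finset.sum_sigma']
    simp only [map_sum, coeff_C_mul, coeff_X_pow, mul_ite, mul_one, mul_zero]
    rw [← Finset.sum_filter]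
    symm
    refine Finset.sum_nbij (fun x => ((x.2.1 : ℤ) - N, (x.2.2 : ℤ) - N)) ?_ ?_ ?_ ?_
    · rintro ⟨⟨i, m⟩, j, k⟩ h
      simp only [Finset.mem_filter] at h
      rw [hF]
      exact h.2.symm
    · rintro ⟨⟨i, m⟩, j, k⟩ h ⟨⟨i', m'⟩, j', k'⟩ h' heq
      simp only [Finset.coe_filter, Finset.mem_sigma, mem_antidiagonal, Set.mem_ofPred_eq,
        Prod.mk.injEq] at h h' heq
      obtain ⟨⟨ha, hb⟩, -⟩ := h
      obtain ⟨⟨ha', hb'⟩, -⟩ := h'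
      obtain rfl : j = j' := by omega
      obtain rfl : k = k' := by omega
      obtain rfl : m = m' := by omega
      obtain rfl : i = i' := by omega
      rfl
    · rintro ⟨a, b⟩ h
      have hab := (hF _ _).mp h
      obtain ⟨ha, hb, hc⟩ := mul_abs_le_thetaExp_add hs a b
      rw [hab] at ha hb hc
      have hle : ∀ w : ℤ, d * |w| ≤ n + (d : ℤ) → |w| ≤ N := by
        intro w hw
        by_contra! hlt
        have : (1 : ℤ) ≤ d := by omega
        nlinarith
      have ha' := abs_le.mp (hle _ ha)
      have hb' := abs_le.mp (hle _ hb)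
      have hc' := abs_le.mp (hle _ hc)
      refine ⟨⟨((N - a - b).toNat, ((a + N) + (b + N)).toNat), ((a + N).toNat, (b + N).toNat)⟩,
        ?_, ?_⟩
      · have e1 : (((a + N).toNat : ℤ) - N, ((b + N).toNat : ℤ) - N) = (a, b) := by
          ext <;> simp only <;> omega
        simp only [Finset.coe_filter, Finset.mem_sigma, mem_antidiagonal, Set.mem_ofPred_eq]
        refine ⟨⟨by omega, by omega⟩, ?_⟩
        rw [e1, hab]
      · ext <;> simp only <;> omega
    · intro x _
      rfl
  obtain ⟨r₁, h₁⟩ := h1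
  obtain ⟨r₂, h₂⟩ := h2
  obtain ⟨r₃, h₃⟩ := hE' N
  refine ⟨r₁ * E' - r₂ * E' - E ^ 3 * r₃, ?_⟩
  linear_combination E' * h₁ - E' * h₂ - E ^ 3 * h₃

end Limit

section Euler

variable {R : Type*} [CommRing R]

theorem V_X : V R X = X ^ 3 := expand_X 3 _

theorem V_injective : Function.Injective (V R) := fun a b h => by
  ext n
  simpa only [V, coeff_expand_mul] using congrArg (coeff (3 * n)) h

theorem IsEulerProd.V {d : ℕ} {E : R⟦X⟧} (hE : IsEulerProd d E) :
    IsEulerProd (3 * d) (ThreeAdic.V R E) := by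
  intro n
  have h := map_dvd (ThreeAdic.V R) (hE n)
  simp only [qPoch, map_sub, map_prod, map_pow, map_one, V_X] at h ⊢
  simpa only [← pow_mul, mul_assoc] using h

theorem IsEulerProd.map {S : Type*} [CommRing S] (φ : R →+* S) {d : ℕ} {E : R⟦X⟧}
    (hE : IsEulerProd d E) : IsEulerProd d (PowerSeries.map φ E) := by
  intro n
  have h := map_dvd (PowerSeries.map φ) (hE n)
  simpa only [qPoch, map_sub, map_prod, map_pow, map_one, map_X] using h

open scoped PowerSeries.WithPiTopology in
/-- The Euler product `∏_{n ≥ 1} (1 - qⁿ)`. -/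
noncomputable def eulerProd : ℚ⟦X⟧ := ∏' n : ℕ, (1 - X ^ (n + 1) : ℚ⟦X⟧)

open scoped PowerSeries.WithPiTopology in
theorem isEulerProd_eulerProd : IsEulerProd 1 eulerProd := by
  intro n
  rw [X_pow_dvd_iff]
  intro k hk
  rw [map_sub, sub_eq_zero]
  have h := (PowerSeries.WithPiTopology.multipliable_one_sub_X_pow ℚ).hasProd.tendsto_prod_nat
  have h' := ((PowerSeries.WithPiTopology.continuous_coeff ℚ k).tendsto _).comp h
  refine tendsto_nhds_unique h' (tendsto_const_nhds.congr' ?_)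
  filter_upwards [Filter.eventually_ge_atTop n] with m hm
  -- further factors do not change the coefficients of `q ^ k` for `k ≤ n`
  induction m, hm using Nat.le_induction with
  | base => simp [qPoch]
  | succ m hm ih =>
    rw [ih]
    simp only [Function.comp, Finset.prod_range_succ, mul_sub, mul_one, map_sub]
    rw [coeff_mul_X_pow', if_neg (by omega), sub_zero]

open scoped PowerSeries.WithPiTopology in
theorem Delta_eq : Delta = X * eulerProd ^ 24 := by
  rw [Delta, eulerProd, (PowerSeries.WithPiTopology.multipliable_one_sub_X_pow ℚ).tprod_pow]

theorem IsEulerProd.dvd_central {d : ℕ} (hd : 0 < d) {E : R⟦X⟧} (hE : IsEulerProd d E) {M N : ℕ}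
    (h : N ≤ M) : (X : R⟦X⟧) ^ N ∣ gaussBinom (X ^ d) (2 * M) M * E - 1 := by
  rw [two_mul]
  refine (pow_dvd_pow X ?_).trans (hE.dvd_gaussBinom_mul_sub_one hd le_rfl le_rfl)
  nlinarith

/-- The Borweins' cubic theta function `b`: `(q; q)³ / (q³; q³)` as a theta sum with a cubic
character. -/
theorem IsEulerProd.cubic_b {ζ : R} (hζ : 1 + ζ + ζ ^ 2 = 0) {E E' T : R⟦X⟧}
    (hE : IsEulerProd 1 E) (hE' : IsEulerProd 3 E') {F : ℕ → Finset (ℤ × ℤ)}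
    (hF : ∀ n p, p ∈ F n ↔ thetaExp 1 0 p = n)
    (hT : ∀ n, coeff n T = ∑ p ∈ F n, thetaWeight ζ p) : E ^ 3 = E' * T := by
  refine hE.pow_three_eq one_pos (by norm_num) (by linear_combination (ζ - 1) * hζ)
    (H := fun N => gaussBinom (X ^ 3) (2 * N) N) (fun N => ?_)
    (fun N => hE'.dvd_central (by norm_num) le_rfl) hF hT
  have hζ' : (1 + C ζ + C ζ ^ 2 : R⟦X⟧) = 0 := by
    rw [← map_pow, ← map_one C, ← map_add, ← map_add, hζ, map_zero]
  rw [pow_zero, mul_one, rothePoly_mul_twist _ _ hζ', Polynomial.coeff_expand (by norm_num),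
    if_pos (dvd_mul_right _ _), Nat.mul_div_cancel_left _ (by norm_num), coeff_rothePoly, pow_one]
  ring

/-- The Borweins' `c`, divided by `3 q^(1/3)`: `(q³; q³)³ / (q; q)` as a theta sum over a shifted
lattice. -/
theorem IsEulerProd.cubic_c {E E' T : R⟦X⟧}
    (hE : IsEulerProd 3 E) (hE' : IsEulerProd 1 E') {F : ℕ → Finset (ℤ × ℤ)}
    (hF : ∀ n p, p ∈ F n ↔ thetaExp 3 1 p = n)
    (hT : ∀ n, coeff n T = ((F n).card : R)) : E ^ 3 = E' * T := by
  refine hE.pow_three_eq (ζ := 1) (by norm_num) (by norm_num) (one_pow 3)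
    (H := fun N => gaussBinom (X ^ 1) (2 * (3 * N)) (3 * N)) (fun N => ?_)
    (fun N => hE'.dvd_central one_pos (by omega)) hF (fun n => by simp [hT, thetaWeight])
  have h := rothePoly_mul_interleave (X : R⟦X⟧) (-1) (2 * N)
  simp only [mul_neg_one] at h
  rw [map_one, one_mul, pow_one, h, coeff_rothePoly, pow_mul (-1 : R⟦X⟧) 3 N]
  have hc : ∀ n : ℕ, (3 * n).choose 2 = 3 * (3 * n.choose 2 + 1 * n) := by
    intro n
    induction n with
    | zero => rfl
    | succ n ih =>
      rw [show 3 * (n + 1) = 3 * n + 1 + 1 + 1 by ring]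
      simp only [Nat.choose_succ_succ' _ 1, Nat.choose_one_right, Nat.reduceAdd]
      omega
  rw [hc, show 3 * (2 * N) = 2 * (3 * N) by ring, show ((-1 : R⟦X⟧) ^ 3) = -1 by ring]
  ring

end Euler

/-! ### Counting representations -/

/-- The lattice points `p` with `thetaExp d s p = n`, cut out of a box that contains them all. -/
noncomputable def thetaFiber (d s n : ℕ) : Finset (ℤ × ℤ) :=
  (Finset.Icc (-(n + 1 : ℤ)) (n + 1) ×ˢ Finset.Icc (-(n + 1 : ℤ)) (n + 1)).filter
    fun p => thetaExp d s p = n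

theorem mem_thetaFiber {d s : ℕ} (hd : 0 < d) (hs : 3 * s ≤ d) (n : ℕ) (p : ℤ × ℤ) :
    p ∈ thetaFiber d s n ↔ thetaExp d s p = n := by
  obtain ⟨a, b⟩ := p
  refine ⟨fun h => (Finset.mem_filter.mp h).2, fun h => Finset.mem_filter.mpr ⟨?_, h⟩⟩
  obtain ⟨ha, hb, -⟩ := mul_abs_le_thetaExp_add hs a b
  rw [h] at ha hb
  have hle : ∀ w : ℤ, d * |w| ≤ n + (d : ℤ) → |w| ≤ n + 1 := by
    intro w hw
    by_contra! hlt
    have : (1 : ℤ) ≤ d := by omega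
    nlinarith
  have ha' := abs_le.mp (hle _ ha)
  have hb' := abs_le.mp (hle _ hb)
  simp only [Finset.mem_product, Finset.mem_Icc]
  omega

theorem mem_thetaFiber_one_zero {n : ℕ} {p : ℤ × ℤ} :
    p ∈ thetaFiber 1 0 n ↔ p.1 ^ 2 + p.1 * p.2 + p.2 ^ 2 = n := by
  rw [mem_thetaFiber one_pos (by norm_num), ← Int.natCast_inj, coe_thetaExp (by norm_num)]
  simp

theorem mem_thetaFiber_three_one {n : ℕ} {p : ℤ × ℤ} :
    p ∈ thetaFiber 3 1 n ↔ 3 * (p.1 ^ 2 + p.1 * p.2 + p.2 ^ 2) + (p.1 + 2 * p.2) = n := by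
  rw [mem_thetaFiber (by norm_num) (by norm_num), ← Int.natCast_inj, coe_thetaExp (by norm_num)]
  simp

theorem coeff_theta (n : ℕ) : coeff n theta = ((thetaFiber 1 0 n).card : ℚ) := by
  rw [theta, coeff_mk, ← Set.ncard_coe_finset]
  congr 2
  ext p
  rw [Finset.mem_coe, mem_thetaFiber_one_zero]
  rfl

/-- The norm form is congruent to `(a - b)²` modulo `3`. -/
theorem norm_form_mod_three {a b : ℤ} {n : ℕ} (h : a ^ 2 + a * b + b ^ 2 = n) :
    ((n : ℤ) % 3 = 0 ∧ (a - b) % 3 = 0) ∨ ((n : ℤ) % 3 = 1 ∧ (a - b) % 3 ≠ 0) := by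
  obtain ⟨k, hk⟩ : ∃ k, k = a - b := ⟨_, rfl⟩
  have hn : (n : ℤ) = k ^ 2 + 3 * (a * b) := by rw [← h, hk]; ring
  rw [← hk, hn]
  have : k % 3 = 0 ∨ k % 3 = 1 ∨ k % 3 = 2 := by omega
  rcases this with h | h | h <;> simp [Int.add_mul_emod_self_left, pow_two, Int.mul_emod, h]

/-- Multiplication by `√-3` maps the vectors of norm `n` onto those of norm `3 n`. -/
theorem card_thetaFiber_three_mul (n : ℕ) :
    (thetaFiber 1 0 (3 * n)).card = (thetaFiber 1 0 n).card := by
  refine Finset.card_nbij' (fun p => (p.1 + (p.2 - p.1) / 3, (p.2 - p.1) / 3))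
    (fun p => (p.1 - p.2, p.1 + 2 * p.2)) ?_ ?_ ?_ ?_
  · rintro ⟨a, b⟩ h
    rw [Finset.mem_coe, mem_thetaFiber_one_zero] at *
    have h3 : (b - a) % 3 = 0 := by
      rcases norm_form_mod_three h with h | h <;> omega
    simp only at h ⊢
    obtain ⟨k, hk⟩ : ∃ k, b = a + 3 * k := ⟨(b - a) / 3, by omega⟩
    rw [show (b - a) / 3 = k by omega]
    subst hk
    push_cast at h
    linarith
  · rintro ⟨a, b⟩ h
    rw [Finset.mem_coe, mem_thetaFiber_one_zero] at *
    push_cast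
    simp only at h ⊢
    linear_combination 3 * h
  · rintro ⟨a, b⟩ h
    rw [Finset.mem_coe, mem_thetaFiber_one_zero] at h
    have h3 : (b - a) % 3 = 0 := by
      rcases norm_form_mod_three h with h | h <;> omega
    ext <;> simp only <;> omega
  · rintro ⟨a, b⟩ h
    ext <;> simp only <;> omega

theorem thetaFiber_three_mul_add_two (n : ℕ) : thetaFiber 1 0 (3 * n + 2) = ∅ := by
  refine Finset.eq_empty_of_forall_notMem fun p h => ?_
  rcases norm_form_mod_three (mem_thetaFiber_one_zero.mp h) with h | h <;> omega

/-- The vectors of norm `3 n + 1` fall into six classes modulo `3`, permuted simply transitively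
by the six units of the Eisenstein integers; the class of `(0, 1)` is the shifted lattice. -/
theorem card_thetaFiber_three_mul_add_one (n : ℕ) :
    (thetaFiber 1 0 (3 * n + 1)).card = 6 * (thetaFiber 3 1 n).card := by
  have key : ∀ (r₁ r₂ : ℤ) (i j : ℤ × ℤ → ℤ × ℤ),
      (∀ p, (i p).1 ^ 2 + (i p).1 * (i p).2 + (i p).2 ^ 2 =
        3 * (3 * (p.1 ^ 2 + p.1 * p.2 + p.2 ^ 2) + (p.1 + 2 * p.2)) + 1) →
      (∀ p, (i p).1 % 3 = r₁ ∧ (i p).2 % 3 = r₂) → (∀ p, j (i p) = p) →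
      (∀ p : ℤ × ℤ, p.1 % 3 = r₁ ∧ p.2 % 3 = r₂ → i (j p) = p) →
      {p ∈ thetaFiber 1 0 (3 * n + 1) | p.1 % 3 = r₁ ∧ p.2 % 3 = r₂}.card = (thetaFiber 3 1 n).card := by
    intro r₁ r₂ i j hn hi hji hij
    refine Finset.card_nbij' j i ?_ ?_ ?_ ?_
    · intro p h
      rw [Finset.mem_coe, Finset.mem_filter, mem_thetaFiber_one_zero] at h
      rw [Finset.mem_coe, mem_thetaFiber_three_one]
      have := hn (j p)
      rw [hij p h.2, h.1] at this
      push_cast at this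
      linarith
    · intro p h
      rw [Finset.mem_coe, mem_thetaFiber_three_one] at h
      rw [Finset.mem_coe, Finset.mem_filter, mem_thetaFiber_one_zero, hn, h]
      exact ⟨by push_cast; ring, hi p⟩
    · intro p h
      exact hij p (Finset.mem_filter.mp h).2
    · intro p _
      exact hji p
  have hmaps : Set.MapsTo (fun p : ℤ × ℤ => (p.1 % 3, p.2 % 3)) (thetaFiber 1 0 (3 * n + 1))
      ({(0, 1), (0, 2), (1, 0), (2, 0), (1, 2), (2, 1)} : Finset (ℤ × ℤ)) := by
    rintro ⟨a, b⟩ h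
    rw [Finset.mem_coe, mem_thetaFiber_one_zero] at h
    have h3 : (a - b) % 3 ≠ 0 := by
      rcases norm_form_mod_three h with h | h <;> omega
    simp only [Finset.coe_insert, Finset.coe_singleton, Set.mem_insert_iff,
      Set.mem_singleton_iff, Prod.mk.injEq]
    omega
  rw [Finset.card_eq_sum_card_fiberwise hmaps]
  simp only [Finset.sum_insert, Finset.mem_insert, Finset.mem_singleton, Prod.mk.injEq,
    Finset.sum_singleton, zero_ne_one, OfNat.ofNat_ne_zero, OfNat.ofNat_ne_one, one_ne_zero,
    OfNat.one_ne_ofNat, OfNat.zero_ne_ofNat, and_false, false_and, or_self, not_false_eq_true]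
  rw [key 0 1 (fun p => (3 * p.1, 3 * p.2 + 1)) (fun p => (p.1 / 3, p.2 / 3)),
    key 0 2 (fun p => (-3 * p.1, -3 * p.2 - 1)) (fun p => (-p.1 / 3, -p.2 / 3)),
    key 1 0 (fun p => (3 * p.2 + 1, 3 * p.1)) (fun p => (p.2 / 3, p.1 / 3)),
    key 2 0 (fun p => (-3 * p.2 - 1, -3 * p.1)) (fun p => (-p.2 / 3, -p.1 / 3)),
    key 1 2 (fun p => (3 * p.2 + 1, -3 * p.1 - 3 * p.2 - 1))
      (fun p => ((-p.1 - p.2) / 3, p.1 / 3)),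
    key 2 1 (fun p => (-3 * p.2 - 1, 3 * p.1 + 3 * p.2 + 1))
      (fun p => ((p.1 + p.2) / 3, -p.1 / 3))]
  · ring
  all_goals first
    | (intro p; ring1)
    | (intro p; constructor <;> simp only <;> omega)
    | (intro p; ext <;> simp only <;> omega)
    | (rintro ⟨a, b⟩ h; ext <;> simp only at h ⊢ <;> omega)

/-! ### The cubic theta identities -/

/-- The theta series of the shifted lattice, `∑ q^(3(a² + ab + b²) + a + 2b)`. -/
noncomputable def shiftedTheta : ℚ⟦X⟧ := PowerSeries.mk fun n => ((thetaFiber 3 1 n).card : ℚ)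

theorem isEulerProd_V_eulerProd : IsEulerProd 3 (V ℚ eulerProd) := isEulerProd_eulerProd.V

theorem V_eulerProd_pow_three : V ℚ eulerProd ^ 3 = eulerProd * shiftedTheta :=
  isEulerProd_V_eulerProd.cubic_c isEulerProd_eulerProd
    (mem_thetaFiber (by norm_num) (by norm_num)) fun n => by rw [shiftedTheta, coeff_mk]

theorem coeff_V {R : Type*} [CommRing R] (φ : R⟦X⟧) (n : ℕ) :
    coeff n (V R φ) = if 3 ∣ n then coeff (n / 3) φ else 0 := coeff_expand 3 (by norm_num) φ

/-- The dissection of `θ` by the norm modulo `3`. -/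
theorem theta_eq : theta = V ℚ theta + 6 * (X * V ℚ shiftedTheta) := by
  ext n
  rw [map_add, show (6 : ℚ⟦X⟧) = C 6 from (map_ofNat C 6).symm, coeff_C_mul, coeff_theta]
  obtain ⟨k, hk⟩ : ∃ k, n = 3 * k ∨ n = 3 * k + 1 ∨ n = 3 * k + 2 := ⟨n / 3, by omega⟩
  have hX : coeff (3 * k) (X * V ℚ shiftedTheta) = 0 := by
    cases k with
    | zero => simp
    | succ k =>
      rw [show 3 * (k + 1) = 3 * k + 2 + 1 by ring, coeff_succ_X_mul, coeff_V, if_neg (by omega)]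
  rcases hk with rfl | rfl | rfl
  · rw [card_thetaFiber_three_mul, hX, coeff_V, if_pos (by omega),
      Nat.mul_div_cancel_left _ (by norm_num), coeff_theta]
    ring
  · rw [card_thetaFiber_three_mul_add_one, coeff_succ_X_mul, coeff_V, coeff_V, if_neg (by omega),
      if_pos (by omega), Nat.mul_div_cancel_left _ (by norm_num), shiftedTheta, coeff_mk]
    push_cast
    ring
  · rw [thetaFiber_three_mul_add_two, show 3 * k + 2 = 3 * k + 1 + 1 by ring, coeff_succ_X_mul,
      coeff_V, coeff_V, if_neg (by omega), if_neg (by omega)]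
    simp

theorem exists_cube_root : ∃ ζ : ℂ, 1 + ζ + ζ ^ 2 = 0 := by
  have h := (Complex.isPrimitiveRoot_exp 3 (by norm_num)).geom_sum_eq_zero (by norm_num)
  exact ⟨_, by simpa [Finset.sum_range_succ] using h⟩

/-- Summing `ζ ^ (a + 2b)` over the vectors of norm `n`: the swap `(a, b) ↦ (b, a)` conjugates the
weight, and weight plus conjugate is `2` or `-1`. -/
theorem two_mul_sum_thetaWeight {ζ : ℂ} (hζ : 1 + ζ + ζ ^ 2 = 0) (n : ℕ) :
    2 * ∑ p ∈ thetaFiber 1 0 n, thetaWeight ζ p =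
      ((3 * coeff n (V ℚ theta) - coeff n theta : ℚ) : ℂ) := by
  have hswap : ∑ p ∈ thetaFiber 1 0 n, thetaWeight ζ p =
      ∑ p ∈ thetaFiber 1 0 n, thetaWeight ζ p.swap := by
    refine Finset.sum_nbij' Prod.swap Prod.swap ?_ ?_ ?_ ?_ ?_
    · intro p h
      rw [mem_thetaFiber_one_zero] at h ⊢
      simp only [Prod.fst_swap, Prod.snd_swap]
      linarith
    · intro p h
      rw [mem_thetaFiber_one_zero] at h ⊢
      simp only [Prod.fst_swap, Prod.snd_swap]
      linarith
    all_goals simp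
  have hsum : 2 * ∑ p ∈ thetaFiber 1 0 n, thetaWeight ζ p =
      ∑ p ∈ thetaFiber 1 0 n, (thetaWeight ζ p + thetaWeight ζ p.swap) := by
    rw [Finset.sum_add_distrib, ← hswap, two_mul]
  rw [hsum, coeff_theta, coeff_V]
  by_cases h3 : 3 ∣ n
  · obtain ⟨k, rfl⟩ := h3
    rw [if_pos (by omega), Nat.mul_div_cancel_left _ (by norm_num), coeff_theta,
      ← card_thetaFiber_three_mul]
    have : ∀ p ∈ thetaFiber 1 0 (3 * k), thetaWeight ζ p + thetaWeight ζ p.swap = 2 := by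
      rintro ⟨a, b⟩ h
      have h0 : (a - b) % 3 = 0 := by
        rcases norm_form_mod_three (mem_thetaFiber_one_zero.mp h) with h | h <;>
          simp only at h <;> omega
      have h1 : (a + 2 * b) % 3 = 0 := by omega
      have h2 : (b + 2 * a) % 3 = 0 := by omega
      simp only [thetaWeight, Prod.swap, h1, h2]
      norm_num
    rw [Finset.sum_congr rfl this, Finset.sum_const, nsmul_eq_mul]
    push_cast
    ring
  · rw [if_neg h3]
    have : ∀ p ∈ thetaFiber 1 0 n, thetaWeight ζ p + thetaWeight ζ p.swap = -1 := by
      rintro ⟨a, b⟩ h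
      have h0 : (a - b) % 3 ≠ 0 := by
        rcases norm_form_mod_three (mem_thetaFiber_one_zero.mp h) with h | h <;>
          simp only at h <;> omega
      have h1 : ((a + 2 * b) % 3 = 1 ∧ (b + 2 * a) % 3 = 2) ∨
          ((a + 2 * b) % 3 = 2 ∧ (b + 2 * a) % 3 = 1) := by
        have h' : (a - b) % 3 = 1 ∨ (a - b) % 3 = 2 := by omega
        rcases h' with h' | h'
        · left; omega
        · right; omega
      rcases h1 with ⟨h1, h2⟩ | ⟨h1, h2⟩ <;> simp only [thetaWeight, Prod.swap, h1, h2,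
        show Int.toNat 1 = 1 from rfl, show Int.toNat 2 = 2 from rfl] <;> linear_combination hζ
    rw [Finset.sum_congr rfl this, Finset.sum_const, nsmul_eq_mul]
    push_cast
    ring

theorem map_V {R S : Type*} [CommRing R] [CommRing S] (φ : R →+* S) (a : R⟦X⟧) :
    PowerSeries.map φ (V R a) = V S (PowerSeries.map φ a) := map_expand 3 _ φ a

theorem map_algebraMap_injective :
    Function.Injective (PowerSeries.map (algebraMap ℚ ℂ)) := fun a b h => by
  ext n
  simpa using congrArg (coeff n) h

/-- `(q; q)³ = (q³; q³) (θ(q³) - 3 q ∑ q^(9(a² + ab + b²) + 3(a + 2b)))`. -/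
theorem eulerProd_pow_three :
    eulerProd ^ 3 = V ℚ eulerProd * (V ℚ theta - 3 * (X * V ℚ shiftedTheta)) := by
  obtain ⟨ζ, hζ⟩ := exists_cube_root
  apply map_algebraMap_injective
  rw [map_pow, map_mul]
  refine (isEulerProd_eulerProd.map _).cubic_b hζ (isEulerProd_V_eulerProd.map _)
    (mem_thetaFiber one_pos (by norm_num)) fun n => ?_
  have h := two_mul_sum_thetaWeight hζ n
  have h2 : 2 * (V ℚ theta - 3 * (X * V ℚ shiftedTheta)) = 3 * V ℚ theta - theta := by
    linear_combination theta_eq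
  have h3 := congrArg (coeff n) h2
  rw [show (2 : ℚ⟦X⟧) = C 2 from (map_ofNat C 2).symm, coeff_C_mul, map_sub (coeff n) (3 * _),
    show (3 : ℚ⟦X⟧) * V ℚ theta = C 3 * V ℚ theta from by rw [map_ofNat], coeff_C_mul] at h3
  rw [← h3] at h
  push_cast at h
  rw [coeff_map]
  exact (mul_left_cancel₀ two_ne_zero h).symm

section Twist

variable {S : Type*} [CommRing S]

/-- The product of `(x; x)`, `(ζx; ζx)` and `(ζ²x; ζ²x)`, for a primitive cube root of unity `ζ`:
the factors of index prime to `3` combine to factors `1 - x³ᵐ`. -/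
theorem qPoch_mul_twist (x ζ : S) (hζ : 1 + ζ + ζ ^ 2 = 0) (n : ℕ) :
    qPoch x (3 * n) * qPoch (ζ * x) (3 * n) * qPoch (ζ ^ 2 * x) (3 * n) * qPoch (x ^ 9) n =
      qPoch (x ^ 3) n ^ 3 * qPoch (x ^ 3) (3 * n) := by
  have h3 : ζ ^ 3 = 1 := by linear_combination (ζ - 1) * hζ
  induction n with
  | zero => simp [qPoch]
  | succ n ih =>
    have e0 : ζ ^ (3 * n) = 1 := by rw [pow_mul, h3, one_pow]
    have e0' : (ζ ^ 2) ^ (3 * n) = 1 := by rw [← pow_mul, mul_comm, pow_mul, e0, one_pow]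
    have f1 : ∀ t : S, (1 - t) * (1 - ζ * t) * (1 - ζ ^ 2 * t) = 1 - t ^ 3 := fun t => by
      linear_combination (-t + t ^ 2 * ζ) * hζ - t ^ 3 * h3
    have s1 : ∀ w : S, qPoch w (3 * (n + 1)) = qPoch w (3 * n) *
        ((1 - w ^ (3 * n + 1)) * (1 - w ^ (3 * n + 2)) * (1 - w ^ (3 * n + 3))) := fun w => by
      rw [show 3 * (n + 1) = 3 * n + 1 + 1 + 1 by ring, qPoch_succ, qPoch_succ, qPoch_succ]
      ring
    have t1 : (ζ * x) ^ (3 * n + 1) = ζ * x ^ (3 * n + 1) := by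
      rw [mul_pow, pow_succ ζ, e0, one_mul]
    have t2 : (ζ * x) ^ (3 * n + 2) = ζ ^ 2 * x ^ (3 * n + 2) := by
      rw [mul_pow, pow_add ζ, e0, one_mul]
    have t3 : (ζ * x) ^ (3 * n + 3) = x ^ (3 * n + 3) := by
      rw [mul_pow, pow_add ζ, e0, one_mul, h3, one_mul]
    have u1 : (ζ ^ 2 * x) ^ (3 * n + 1) = ζ ^ 2 * x ^ (3 * n + 1) := by
      rw [mul_pow, pow_succ (ζ ^ 2), e0', one_mul]
    have u2 : (ζ ^ 2 * x) ^ (3 * n + 2) = ζ * x ^ (3 * n + 2) := by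
      rw [mul_pow, pow_add (ζ ^ 2), e0', one_mul]
      linear_combination ζ * x ^ (3 * n + 2) * h3
    have u3 : (ζ ^ 2 * x) ^ (3 * n + 3) = x ^ (3 * n + 3) := by
      rw [mul_pow, pow_add (ζ ^ 2), e0', one_mul, ← pow_mul, mul_comm 2 3, pow_mul, h3, one_pow,
        one_mul]
    have g1 := f1 (x ^ (3 * n + 1))
    have g2 := f1 (x ^ (3 * n + 2))
    rw [s1 x, s1 (ζ * x), s1 (ζ ^ 2 * x), s1 (x ^ 3), qPoch_succ (x ^ 9), qPoch_succ (x ^ 3) n,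
      t1, t2, t3, u1, u2, u3]
    have v1 : (x ^ 9) ^ (n + 1) = (x ^ (3 * n + 3)) ^ 3 := by ring
    have v2 : (x ^ 3) ^ (n + 1) = x ^ (3 * n + 3) := by ring
    have v3 : ∀ m, (x ^ 3) ^ m = (x ^ m) ^ 3 := fun m => by ring
    rw [v1, v2, v3, v3, v3]
    generalize x ^ (3 * n + 1) = a at *
    generalize x ^ (3 * n + 2) = b at *
    generalize x ^ (3 * n + 3) = c at *
    rw [← g1, ← g2]
    linear_combination ((1 - a) * (1 - ζ * a) * (1 - ζ ^ 2 * a)) *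
      ((1 - b) * (1 - ζ * b) * (1 - ζ ^ 2 * b)) * (1 - c) ^ 3 * (1 - c ^ 3) * ih

theorem rescale_V {ζ : S} (hζ : ζ ^ 3 = 1) (a : S⟦X⟧) : rescale ζ (V S a) = V S a := by
  ext n
  rw [coeff_rescale, coeff_V]
  split_ifs with h
  · obtain ⟨k, rfl⟩ := h
    rw [pow_mul, hζ, one_pow, one_mul]
  · rw [mul_zero]

theorem IsEulerProd.mul_twist {E : S⟦X⟧} (hE : IsEulerProd 1 E) {ζ : S}
    (hζ : 1 + ζ + ζ ^ 2 = 0) :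
    E * rescale ζ E * rescale (ζ ^ 2) E * ThreeAdic.V S (ThreeAdic.V S E) =
      ThreeAdic.V S E ^ 4 := by
  have hE3 : IsEulerProd 3 (ThreeAdic.V S E) := hE.V
  have hE9 : IsEulerProd 9 (ThreeAdic.V S (ThreeAdic.V S E)) := hE3.V
  suffices h : ∀ n, (X : S⟦X⟧) ^ n ∣ E * rescale ζ E * rescale (ζ ^ 2) E *
      ThreeAdic.V S (ThreeAdic.V S E) - ThreeAdic.V S E ^ 4 by
    ext n
    simpa [sub_eq_zero] using X_pow_dvd_iff.mp (h (n + 1)) n (Nat.lt_succ_self n)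
  intro n
  have hmod : ∀ {d : ℕ} {A : S⟦X⟧}, 0 < d → IsEulerProd d A → ∀ m, n ≤ m →
      (X : S⟦X⟧) ^ n ∣ A - qPoch (X ^ d) m := fun hd hA m hm =>
    (pow_dvd_pow X (by nlinarith)).trans (hA m)
  have hres : ∀ ξ : S, (X : S⟦X⟧) ^ n ∣ rescale ξ E - qPoch (C ξ * X) (3 * n) := by
    intro ξ
    have h := map_dvd (rescale ξ) (hmod one_pos hE (3 * n) (by omega))
    simp only [qPoch, map_sub, map_prod, map_pow, map_one, rescale_X, pow_one] at h
    rw [mul_pow] at h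
    exact (dvd_mul_left _ _).trans h
  have h0 := hmod one_pos hE (3 * n) (by omega)
  have h3 := hmod (by norm_num) hE3 n le_rfl
  have h3' := hmod (by norm_num) hE3 (3 * n) (by omega)
  have h9 := hmod (by norm_num) hE9 n le_rfl
  have h1 := hres ζ
  have h2 := hres (ζ ^ 2)
  have hζ' : (1 + C ζ + C ζ ^ 2 : S⟦X⟧) = 0 := by
    rw [← map_pow, ← map_one C, ← map_add, ← map_add, hζ, map_zero]
  have key := qPoch_mul_twist (X : S⟦X⟧) (C ζ) hζ' n
  rw [← map_pow C] at key
  rw [pow_one] at h0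
  rw [← Ideal.mem_span_singleton, ← Ideal.Quotient.eq] at h0 h1 h2 h3 h3' h9 ⊢
  have key' := congrArg (Ideal.Quotient.mk (Ideal.span {(X : S⟦X⟧) ^ n})) key
  simp only [map_mul, map_pow _ (qPoch _ _), map_pow _ (ThreeAdic.V S E)] at key' ⊢
  rw [h0, h1, h2, h9, key', ← h3, ← h3']
  ring

end Twist

/-- With `A = θ(q³)` and `C = 3 q g(q³)` for the shifted theta series `g`, a form of the Borweins'
`b³ = A³ - C³`. It is `eulerProd_pow_three`, which says `A - C = E(q)³ / E(q³)`, multiplied over the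
substitutions `q ↦ ζ q`: these fix `A` and multiply `C` by `ζ`. -/
theorem V_eulerProd_pow_nine : V ℚ eulerProd ^ 9 = V ℚ (V ℚ eulerProd) ^ 3 *
    (V ℚ theta ^ 3 - (3 * (X * V ℚ shiftedTheta)) ^ 3) := by
  obtain ⟨ζ, hζ⟩ := exists_cube_root
  have hζ3 : ζ ^ 3 = 1 := by linear_combination (ζ - 1) * hζ
  have hζ6 : (ζ ^ 2) ^ 3 = 1 := by rw [← pow_mul, mul_comm, pow_mul, hζ3, one_pow]
  apply map_algebraMap_injective
  have h0 := congrArg (PowerSeries.map (algebraMap ℚ ℂ)) eulerProd_pow_three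
  have hE := isEulerProd_eulerProd.map (algebraMap ℚ ℂ)
  have ht := hE.mul_twist hζ
  simp only [map_mul, map_pow, map_sub, map_V, map_X, map_ofNat] at h0 ⊢
  generalize PowerSeries.map (algebraMap ℚ ℂ) eulerProd = E at *
  generalize PowerSeries.map (algebraMap ℚ ℂ) theta = A at *
  generalize PowerSeries.map (algebraMap ℚ ℂ) shiftedTheta = G at *
  have h1 := congrArg (rescale ζ) h0
  have h2 := congrArg (rescale (ζ ^ 2)) h0
  simp only [map_mul, map_pow (rescale _), map_sub, rescale_X, map_ofNat, rescale_V hζ3,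
    rescale_V hζ6] at h1 h2
  have hC : (1 + C ζ + C ζ ^ 2 : ℂ⟦X⟧) = 0 := by
    rw [← map_pow, ← map_one C, ← map_add, ← map_add, hζ, map_zero]
  rw [map_pow] at h2
  have hprod : (E * rescale ζ E * rescale (ζ ^ 2) E) ^ 3 =
      V ℂ E ^ 3 * (V ℂ A ^ 3 - (3 * (X * V ℂ G)) ^ 3) := by
    rw [mul_pow, mul_pow, h0, h1, h2]
    have hC3 : (C ζ ^ 3 : ℂ⟦X⟧) = 1 := by rw [← map_pow, hζ3, map_one]
    linear_combination V ℂ E ^ 3 * (-(V ℂ A) ^ 2 * (3 * (X * V ℂ G)) +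
      V ℂ A * (3 * (X * V ℂ G)) ^ 2 * C ζ) * hC - V ℂ E ^ 3 * (3 * (X * V ℂ G)) ^ 3 * hC3
  have hne : V ℂ E ≠ 0 := by
    intro h
    have := IsEulerProd.constantCoeff_eq_one (d := 3) (by norm_num) hE.V
    simp [h] at this
  refine mul_left_cancel₀ (pow_ne_zero 3 hne) ?_
  calc V ℂ E ^ 3 * V ℂ E ^ 9 = (V ℂ E ^ 4) ^ 3 := by ring
    _ = V ℂ (V ℂ E) ^ 3 * (E * rescale ζ E * rescale (ζ ^ 2) E) ^ 3 := by rw [← ht]; ring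
    _ = _ := by rw [hprod]; ring

/-! ### The operator `U` -/

section Operators

variable {R : Type*} [CommRing R]

theorem coeff_U (φ : R⟦X⟧) (n : ℕ) : coeff n (U R φ) = coeff (3 * n) φ := by simp [U]

theorem U_V (φ : R⟦X⟧) : U R (V R φ) = φ := by
  ext n
  rw [coeff_U, coeff_V, if_pos (dvd_mul_right _ _), Nat.mul_div_cancel_left _ (by norm_num)]

theorem U_X_mul_V (φ : R⟦X⟧) : U R (X * V R φ) = 0 := by
  ext n
  rw [coeff_U, map_zero]
  cases n with
  | zero => simp
  | succ n =>
    rw [show 3 * (n + 1) = 3 * n + 2 + 1 by ring, coeff_succ_X_mul, coeff_V, if_neg (by omega)]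

theorem U_X_sq_mul_V (φ : R⟦X⟧) : U R (X ^ 2 * V R φ) = 0 := by
  ext n
  rw [coeff_U, map_zero]
  cases n with
  | zero => simp
  | succ n =>
    rw [show 3 * (n + 1) = 3 * n + 1 + 2 by ring, coeff_X_pow_mul, coeff_V, if_neg (by omega)]

theorem eq_V_add_X_mul_V (φ : R⟦X⟧) :
    φ = V R (U R φ) + X * V R (PowerSeries.mk fun n => coeff (3 * n + 1) φ) +
      X ^ 2 * V R (PowerSeries.mk fun n => coeff (3 * n + 2) φ) := by
  ext n
  obtain ⟨k, hk⟩ : ∃ k, n = 3 * k ∨ n = 3 * k + 1 ∨ n = 3 * k + 2 := ⟨n / 3, by omega⟩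
  rw [map_add, map_add]
  rcases hk with rfl | rfl | rfl
  · rw [← coeff_U _ k, ← coeff_U _ k, ← coeff_U _ k, ← coeff_U _ k, U_V, U_X_mul_V, U_X_sq_mul_V]
    simp
  · rw [coeff_succ_X_mul, coeff_X_pow_mul', coeff_V, coeff_V, if_neg (by omega),
      if_pos (dvd_mul_right _ _), Nat.mul_div_cancel_left _ (by norm_num), coeff_mk]
    split_ifs
    · rw [coeff_V, if_neg (by omega)]; ring
    · ring
  · rw [show 3 * k + 2 = 3 * k + 1 + 1 by ring, coeff_succ_X_mul,
      show 3 * k + 1 + 1 = 3 * k + 2 by ring, coeff_X_pow_mul, coeff_V, coeff_V, coeff_V,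
      if_neg (by omega), if_neg (by omega), if_pos (dvd_mul_right _ _),
      Nat.mul_div_cancel_left _ (by norm_num), coeff_mk]
    ring

/-- `U` is linear over the image of `V`. -/
theorem U_mul_V (φ ψ : R⟦X⟧) : U R (φ * V R ψ) = U R φ * ψ := by
  conv_lhs => rw [eq_V_add_X_mul_V φ]
  rw [add_mul, add_mul, mul_assoc, mul_assoc, ← map_mul, ← map_mul, ← map_mul, map_add, map_add,
    U_V, U_X_mul_V, U_X_sq_mul_V, add_zero, add_zero]

end Operators

/-! ### The relations between `y` and `f` -/

/-- `U (y³)` as a power series; see `y_pow_three`. -/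
noncomputable def cubeY : ℚ⟦X⟧ := X * (shiftedTheta * theta⁻¹) ^ 3

theorem theta_mul_inv : theta * theta⁻¹ = 1 :=
  PowerSeries.mul_inv_cancel _ (by rw [constantCoeff_theta]; exact one_ne_zero)

theorem V_theta_ne_zero : V ℚ theta ≠ 0 := fun h => by
  simpa [h] using constantCoeff_V_theta

theorem eulerProd_ne_zero : eulerProd ≠ 0 := fun h => by
  simpa [h] using isEulerProd_eulerProd.constantCoeff_eq_one one_pos

theorem V_ne_zero {φ : ℚ⟦X⟧} (h : φ ≠ 0) : V ℚ φ ≠ 0 := fun h' =>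
  h (V_injective (h'.trans (map_zero _).symm))

theorem y_mul_V_theta : y * V ℚ theta = X * V ℚ shiftedTheta := by
  have h := PowerSeries.inv_mul_cancel (V ℚ theta)
    (by rw [constantCoeff_V_theta]; exact one_ne_zero)
  have h6 : (C (1 / 6 : ℚ) * 6 : ℚ⟦X⟧) = 1 := by
    rw [show (6 : ℚ⟦X⟧) = C 6 from (map_ofNat C 6).symm, ← map_mul]
    norm_num
  rw [y]
  linear_combination C (1 / 6 : ℚ) * theta * h + C (1 / 6 : ℚ) * theta_eq +
    X * V ℚ shiftedTheta * h6

theorem y_eq : y = X * V ℚ (shiftedTheta * theta⁻¹) := by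
  refine mul_right_cancel₀ V_theta_ne_zero ?_
  have h := congrArg (V ℚ) theta_mul_inv
  rw [map_mul, map_one] at h
  rw [y_mul_V_theta, map_mul]
  linear_combination -X * V ℚ shiftedTheta * h

theorem y_pow_three : y ^ 3 = V ℚ cubeY := by
  rw [y_eq, cubeY, mul_pow, ← map_pow, map_mul (V ℚ) X, V_X]

theorem constantCoeff_y : constantCoeff y = 0 := by
  rw [y_eq, map_mul, constantCoeff_X, zero_mul]

theorem U_y : U ℚ y = 0 := by rw [y_eq, U_X_mul_V]

theorem U_y_sq : U ℚ (y ^ 2) = 0 := by rw [y_eq, mul_pow, ← map_pow, U_X_sq_mul_V]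

/-- The quotient of `V_eulerProd_pow_nine` by `eulerProd_pow_three`, with the Euler products
eliminated by `V_eulerProd_pow_three`. -/
theorem X_mul_shiftedTheta_pow_three : X * shiftedTheta ^ 3 = X * V ℚ shiftedTheta *
    (V ℚ theta ^ 2 + V ℚ theta * (3 * (X * V ℚ shiftedTheta)) +
      (3 * (X * V ℚ shiftedTheta)) ^ 2) := by
  have h1 := V_eulerProd_pow_three
  have h1' := congrArg (V ℚ) h1
  rw [map_pow, map_mul] at h1'
  have h2 := eulerProd_pow_three
  have h3 := V_eulerProd_pow_nine
  rw [h1'] at h3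
  refine mul_left_cancel₀ (pow_ne_zero 3 eulerProd_ne_zero) ?_
  calc eulerProd ^ 3 * (X * shiftedTheta ^ 3) = X * (eulerProd * shiftedTheta) ^ 3 := by ring
    _ = X * V ℚ eulerProd ^ 9 := by rw [← h1]; ring
    _ = _ := by rw [h2, h3]; ring

theorem cubeY_mul : cubeY * (1 + 6 * y) ^ 3 = y * (1 + 3 * y + 9 * y ^ 2) := by
  refine mul_right_cancel₀ (pow_ne_zero 3 V_theta_ne_zero) ?_
  have h1 : (1 + 6 * y) * V ℚ theta = theta := by
    linear_combination 6 * y_mul_V_theta - theta_eq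
  calc cubeY * (1 + 6 * y) ^ 3 * V ℚ theta ^ 3 = cubeY * ((1 + 6 * y) * V ℚ theta) ^ 3 := by ring
    _ = X * shiftedTheta ^ 3 * (theta * theta⁻¹) ^ 3 := by rw [h1, cubeY]; ring
    _ = X * shiftedTheta ^ 3 := by rw [theta_mul_inv, one_pow, mul_one]
    _ = _ := by rw [X_mul_shiftedTheta_pow_three, ← y_mul_V_theta]; ring

theorem cubeY_eq : cubeY = y * (1 + 3 * y + 9 * y ^ 2) * ((1 + 6 * y) ^ 3)⁻¹ := by
  rw [PowerSeries.eq_mul_inv_iff_mul_eq (by simp [constantCoeff_y]), cubeY_mul]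

theorem f_mul : f * eulerProd ^ 12 = X * V ℚ eulerProd ^ 12 := by
  have hc := isEulerProd_eulerProd.constantCoeff_eq_one one_pos
  have hc0 : constantCoeff (eulerProd ^ 12) ≠ 0 := by simp [hc]
  have hinv := PowerSeries.inv_mul_cancel _ hc0
  have h : f = X * V ℚ eulerProd ^ 12 * (eulerProd ^ 12)⁻¹ := by
    refine existsUnique_sqrt.unique f_spec ⟨?_, ?_⟩
    · rw [Delta_eq, map_mul, V_X, map_pow]
      linear_combination (X ^ 3 * V ℚ eulerProd ^ 24) *
        ((eulerProd ^ 12)⁻¹ * eulerProd ^ 12 + 1) * hinv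
    · rw [mul_assoc, show (1 : ℕ) = 0 + 1 from rfl, coeff_succ_X_mul]
      simp [V, hc]
  rw [h, mul_assoc, hinv, mul_one]

theorem f_mul_one_sub : f * (1 - 3 * y) ^ 3 = y * (1 + 3 * y + 9 * y ^ 2) := by
  have h1 : (1 - 3 * y) * V ℚ theta = V ℚ theta - 3 * (X * V ℚ shiftedTheta) := by
    linear_combination -3 * y_mul_V_theta
  refine mul_right_cancel₀ (pow_ne_zero 3 V_theta_ne_zero) ?_
  refine mul_right_cancel₀ (pow_ne_zero 3 (V_ne_zero eulerProd_ne_zero)) ?_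
  refine mul_right_cancel₀ (pow_ne_zero 3 eulerProd_ne_zero) ?_
  calc f * (1 - 3 * y) ^ 3 * V ℚ theta ^ 3 * V ℚ eulerProd ^ 3 * eulerProd ^ 3
      = f * eulerProd ^ 3 * (V ℚ eulerProd * ((1 - 3 * y) * V ℚ theta)) ^ 3 := by ring
    _ = f * eulerProd ^ 12 := by rw [h1, ← eulerProd_pow_three]; ring
    _ = X * (V ℚ eulerProd ^ 3) ^ 3 * V ℚ eulerProd ^ 3 := by rw [f_mul]; ring
    _ = X * shiftedTheta ^ 3 * V ℚ eulerProd ^ 3 * eulerProd ^ 3 := by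
      rw [V_eulerProd_pow_three]; ring
    _ = _ := by rw [X_mul_shiftedTheta_pow_three, ← y_mul_V_theta]; ring

theorem V_f_mul : V ℚ f * (1 - 27 * y ^ 3) = y ^ 3 := by
  have h1 : (1 - 27 * y ^ 3) * V ℚ theta ^ 3 =
      V ℚ theta ^ 3 - (3 * (X * V ℚ shiftedTheta)) ^ 3 := by
    rw [← y_mul_V_theta]; ring
  have h2 := congrArg (V ℚ) f_mul
  rw [map_mul, map_mul, map_pow, map_pow, V_X] at h2
  have h3 := congrArg (V ℚ) V_eulerProd_pow_three
  rw [map_pow, map_mul] at h3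
  refine mul_right_cancel₀ (pow_ne_zero 3 V_theta_ne_zero) ?_
  refine mul_right_cancel₀ (pow_ne_zero 3 (V_ne_zero (V_ne_zero eulerProd_ne_zero))) ?_
  refine mul_right_cancel₀ (pow_ne_zero 3 (V_ne_zero eulerProd_ne_zero)) ?_
  calc V ℚ f * (1 - 27 * y ^ 3) * V ℚ theta ^ 3 * V ℚ (V ℚ eulerProd) ^ 3 * V ℚ eulerProd ^ 3
      = V ℚ f * (V ℚ (V ℚ eulerProd) ^ 3 * ((1 - 27 * y ^ 3) * V ℚ theta ^ 3)) *
          V ℚ eulerProd ^ 3 := by ring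
    _ = V ℚ f * V ℚ eulerProd ^ 12 := by rw [h1, ← V_eulerProd_pow_nine]; ring
    _ = X ^ 3 * (V ℚ (V ℚ eulerProd) ^ 3) ^ 3 * V ℚ (V ℚ eulerProd) ^ 3 := by rw [h2]; ring
    _ = (X * V ℚ shiftedTheta) ^ 3 * V ℚ (V ℚ eulerProd) ^ 3 * V ℚ eulerProd ^ 3 := by
      nth_rewrite 1 [h3]; ring
    _ = _ := by rw [← y_mul_V_theta]; ring

theorem f_mul_cubeY : f * (1 - 27 * cubeY) = cubeY := by
  apply V_injective
  rw [map_mul, map_sub, map_mul, map_one, map_ofNat, ← y_pow_three, V_f_mul]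

theorem U_y_pow (m : ℕ) : U ℚ (y ^ (3 * m + 1)) = 0 ∧ U ℚ (y ^ (3 * m + 2)) = 0 ∧
    U ℚ (y ^ (3 * m)) = cubeY ^ m := by
  have h : y ^ (3 * m) = V ℚ (cubeY ^ m) := by rw [pow_mul, y_pow_three, map_pow]
  refine ⟨?_, ?_, ?_⟩
  · rw [pow_succ', h, U_mul_V, U_y, zero_mul]
  · rw [pow_add, mul_comm, h, U_mul_V, U_y_sq, zero_mul]
  · rw [h, U_V]

theorem U_f : U ℚ f = 10 * 3 ^ 2 * f + 4 * 3 ^ 7 * f ^ 2 + 3 ^ 11 * f ^ 3 := by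
  have hw : constantCoeff (1 - 27 * cubeY) ≠ 0 := by simp [cubeY]
  have hw0 : 1 - 27 * cubeY ≠ 0 := fun h => hw (by rw [h, map_zero])
  refine mul_right_cancel₀ (pow_ne_zero 3 hw0) ?_
  -- clear denominators by `(1 - 3y)(1 + 3y + 9y²) = 1 - 27y³`, then sort by exponents modulo `3`
  have h1 : f * V ℚ ((1 - 27 * cubeY) ^ 3) =
      V ℚ (90 * cubeY + 3888 * cubeY ^ 2 + 6561 * cubeY ^ 3) +
        y * V ℚ (1 + 432 * cubeY + 7290 * cubeY ^ 2) +
        y ^ 2 * V ℚ (12 + 1539 * cubeY + 8748 * cubeY ^ 2) := by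
    simp only [map_add, map_sub, map_mul, map_pow, map_one, map_ofNat, ← y_pow_three]
    linear_combination (1 + 3 * y + 9 * y ^ 2) ^ 3 * f_mul_one_sub
  rw [← U_mul_V, h1, map_add, map_add, U_V, U_mul_V, U_mul_V, U_y, U_y_sq]
  have h := f_mul_cubeY
  generalize cubeY = z at *
  calc _ = 90 * z * (1 - 27 * z) ^ 2 + 4 * 3 ^ 7 * z ^ 2 * (1 - 27 * z) + 3 ^ 11 * z ^ 3 := by ring
    _ = 90 * (f * (1 - 27 * z)) * (1 - 27 * z) ^ 2 +
        4 * 3 ^ 7 * (f * (1 - 27 * z)) ^ 2 * (1 - 27 * z) + 3 ^ 11 * (f * (1 - 27 * z)) ^ 3 := by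
      rw [h]
    _ = _ := by ring

end ThreeAdic

open ThreeAdic in
theorem mainTheorem5 :
    -- the action of `U` on `y`, `y²`, `y³`
    (U ℚ y = 0 ∧ U ℚ (y ^ 2) = 0 ∧
      U ℚ (y ^ 3) = y * (1 + 3 * y + 9 * y ^ 2) * ((1 + 6 * y) ^ 3)⁻¹) ∧
    -- the action of `U` on all powers of `y`
    (∀ m : ℕ, U ℚ (y ^ (3 * m + 1)) = 0 ∧ U ℚ (y ^ (3 * m + 2)) = 0 ∧
      U ℚ (y ^ (3 * m)) = (y * (1 + 3 * y + 9 * y ^ 2) * ((1 + 6 * y) ^ 3)⁻¹) ^ m) ∧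
    -- the relations between `f` and `y`, and the action of `U` and `V` on `f`
    (f = y * (1 + 3 * y + 9 * y ^ 2) * ((1 - 3 * y) ^ 3)⁻¹ ∧
      U ℚ f = 10 * 3 ^ 2 * f + 4 * 3 ^ 7 * f ^ 2 + 3 ^ 11 * f ^ 3 ∧
      V ℚ f = y ^ 3 * (1 - 27 * y ^ 3)⁻¹) := by
  refine ⟨⟨U_y, U_y_sq, ?_⟩, fun m => ?_, ?_, U_f, ?_⟩
  · rw [y_pow_three, U_V, cubeY_eq]
  · rw [← cubeY_eq]
    exact U_y_pow m
  · rw [PowerSeries.eq_mul_inv_iff_mul_eq (by simp [constantCoeff_y]), f_mul_one_sub]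
  · rw [PowerSeries.eq_mul_inv_iff_mul_eq (by simp [constantCoeff_y]), V_f_mul]
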